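/- Let $G$ be a finite simple connected graph with $n$ vertices and $m\ge 1$ edges. For an integer $k\ge 1$ let $S_k(G)$ be the $k$-parallel subdivision graph, obtained from $G$ by replacing each edge by $k$ parallel paths of length $2$ (i.e. for each edge $uv$ one deletes $uv$ and adds $k$ new vertices, each adjacent to exactly $u$ and $v$), and let $S_k^0(G)=G$, $S_k^{r}(G)=S_k(S_k^{r-1}(G))$. For a connected graph $H$ with at least one edge, Kemeny's constant is $Ke(H)=\sum_{j\in V(H)}\pi_j\,E_iT_j(H)$, where $\pi_j=d_j/(2|E(H)|)$ is the stationary distribution of the simple random walk on $H$ and $E_iT_j(H)$ is the expected value of the hitting time $T_j=\min\{t\ge 0: X_t=j\}$ of that walk started at $i$; it is finite and does not depend on the starting vertex $i$. Then $$Ke(S_k(G))=4\,Ke(G)+\frac{1+2km-2n}{2}\qquad (k\ge 1),$$ and for all integers $k>2$ and $r\ge 1$ $$Ke(S_k^r(G))=4^rKe(G)+\frac{4^r-1}{6}(1-2n)+\frac{2^{r-1}k(k^r-2^r)}{k-2}\,m-\frac{k\left[4^r-2k(4^r-1)+3(2k)^r-4\right]}{6(k-2)(2k-1)}\,m .$$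 -/

import Mathlib

open scoped ENNReal

universe u

/-- A finite simple graph. The vertex type is bundled because the vertex set grows when
the subdivision operation is iterated. -/
structure FiniteGraph where
  /-- the vertex set -/
  V : Type u
  /-- the vertex set is finite -/
  [fintypeV : Fintype V]
  /-- the adjacency structure -/
  graph : SimpleGraph V

attribute [instance] FiniteGraph.fintypeV

namespace FiniteGraph

/-- The number of vertices. -/
def numVerts (G : FiniteGraph.{u}) : ℕ := Fintype.card G.V

/-- The number of edges. -/
noncomputable def numEdges (G : FiniteGraph.{u}) : ℕ := G.graph.edgeSet.ncard

open Classical in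
/-- The degree of a vertex. -/
noncomputable def deg (G : FiniteGraph.{u}) (v : G.V) : ℕ := G.graph.degree v

/-! ### The `k`-parallel subdivision graph -/

/-- Adjacency in `S_k(G)`: the vertices are the vertices of `G` together with one new vertex
`(e, l)` for each edge `e` of `G` and each `l < k`; the new vertex `(e, l)` is joined exactly to
the two endpoints of `e`. So each edge of `G` is replaced by `k` parallel paths of length 2. -/
def parallelAdj (G : FiniteGraph.{u}) (k : ℕ) :
    G.V ⊕ (G.graph.edgeSet × Fin k) → G.V ⊕ (G.graph.edgeSet × Fin k) → Prop
  | .inl v, .inr p => v ∈ (p.1 : Sym2 G.V)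
  | .inr p, .inl v => v ∈ (p.1 : Sym2 G.V)
  | _, _ => False

open Classical in
/-- The `k`-parallel subdivision graph `S_k(G)`. -/
noncomputable def parallelSubdivision (k : ℕ) (G : FiniteGraph.{u}) : FiniteGraph.{u} where
  V := G.V ⊕ (G.graph.edgeSet × Fin k)
  graph :=
    { Adj := G.parallelAdj k
      symm := ⟨by rintro (v | p) (w | q) h <;> exact h⟩
      loopless := ⟨by rintro (v | p) h <;> exact h⟩ }

/-- The iterated graph `S_k^r(G)`: `S_k^0(G) = G` and `S_k^{r+1}(G) = S_k(S_k^r(G))`. -/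
noncomputable def iterParallelSubdivision (k : ℕ) (G : FiniteGraph.{u}) : ℕ → FiniteGraph.{u}
  | 0 => G
  | r + 1 => parallelSubdivision k (iterParallelSubdivision k G r)

/-! ### Simple random walk, hitting times, Kemeny's constant -/

open Classical in
/-- One-step transition probability of the simple random walk: from `a` the walk moves to a
uniformly chosen neighbour. -/
noncomputable def stepProb (G : FiniteGraph.{u}) (a b : G.V) : ℝ :=
  if G.graph.Adj a b then 1 / (G.deg a : ℝ) else 0

open Classical in
/-- The law of the first `t` steps of the walk `X` started at `i`:
`pathProb i x = P(X 0 = x 0, …, X t = x t)`. -/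
noncomputable def pathProb (G : FiniteGraph.{u}) (i : G.V) {t : ℕ} (x : Fin (t + 1) → G.V) : ℝ :=
  if x 0 = i then ∏ s : Fin t, G.stepProb (x s.castSucc) (x s.succ) else 0

open Classical in
/-- With `T_j = min {t ≥ 0 | X t = j}` the hitting time of `j`, this is the probability
`P(T_j > t)` that the walk started at `i` avoids `j` at all times `0, …, t`. -/
noncomputable def hittingTail (G : FiniteGraph.{u}) (i j : G.V) (t : ℕ) : ℝ :=
  ∑ x : Fin (t + 1) → G.V, if ∀ s, x s ≠ j then G.pathProb i x else 0

/-- The expected hitting time `E_i T_j = ∑_{t ≥ 0} P(T_j > t)`, a value in `[0, ∞]`. -/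
noncomputable def expectedHittingTime (G : FiniteGraph.{u}) (i j : G.V) : ℝ≥0∞ :=
  ∑' t : ℕ, ENNReal.ofReal (G.hittingTail i j t)

/-- The stationary distribution `π_j = d_j / 2m` of the simple random walk. -/
noncomputable def stationary (G : FiniteGraph.{u}) (j : G.V) : ℝ :=
  (G.deg j : ℝ) / (2 * (G.numEdges : ℝ))

/-- The expected number of steps that the walk started at `i` needs to reach a destination vertex
chosen at random from the stationary distribution. -/
noncomputable def meanHittingTime (G : FiniteGraph.{u}) (i : G.V) : ℝ≥0∞ :=
  ∑ j : G.V, ENNReal.ofReal (G.stationary j) * G.expectedHittingTime i j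

/-- `K` is Kemeny's constant of `G`: from every starting vertex the expected number of steps to a
destination vertex chosen from the stationary distribution is finite and equal to `K`. -/
def IsKemenyConstant (G : FiniteGraph.{u}) (K : ℝ) : Prop :=
  ∀ i : G.V, G.meanHittingTime i ≠ ∞ ∧ (G.meanHittingTime i).toReal = K

/-- Kemeny's constant of a graph with a vertex is unique. -/
theorem IsKemenyConstant.unique {G : FiniteGraph.{u}} [Nonempty G.V] {K K' : ℝ}
    (h : G.IsKemenyConstant K) (h' : G.IsKemenyConstant K') : K = K' := by
  obtain ⟨i⟩ := ‹Nonempty G.V›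
  rw [← (h i).2, ← (h' i).2]

end FiniteGraph

/-! Hitting times of `j` are the unique solution of a linear system (`IsHittingFunction`), so a
formula for them on `S_k(G)` only has to be checked against that system. Seen at old vertices, the
walk on `S_k(G)` takes two steps to return or to move on to a random neighbour in `G`, each with
probability 1/2. One step in `G` thus costs 4 on average, and old-to-old hitting times are
multiplied by 4. For a new target on the edge `ab`, the hitting function is the average of those of
`a` and `b`, corrected by a constant and a point mass at the target. The constant involves the
commute time of `ab`. Averaging over stationary targets from one old vertex leaves one unknown, the
sum of commute times over the edges, which is `2m(n-1)` (Foster). This proves `kemeny_parallel`;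
`iter_parallel` iterates it together with the counts of vertices and edges. -/

namespace FiniteGraph

/-! ### Neighbour sums and degrees. -/

variable (G : FiniteGraph.{u})

open Classical in
/-- The sum of a function over the neighbours of a vertex. -/
noncomputable def adjSum (f : G.V → ℝ) (v : G.V) : ℝ :=
  ∑ w, if G.graph.Adj v w then f w else 0

variable {G}

theorem deg_eq_adjSum (v : G.V) : (G.deg v : ℝ) = G.adjSum (fun _ => 1) v := by
  classical
  unfold deg adjSum
  rw [← SimpleGraph.card_neighborFinset_eq_degree, SimpleGraph.neighborFinset_eq_filter,
    Finset.sum_boole]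

theorem adjSum_add (f g : G.V → ℝ) (v : G.V) :
    G.adjSum (fun w => f w + g w) v = G.adjSum f v + G.adjSum g v := by
  unfold adjSum
  rw [← Finset.sum_add_distrib]
  exact Finset.sum_congr rfl fun w _ => by split_ifs <;> simp

theorem adjSum_const_mul (c : ℝ) (f : G.V → ℝ) (v : G.V) :
    G.adjSum (fun w => c * f w) v = c * G.adjSum f v := by
  unfold adjSum
  rw [Finset.mul_sum]
  exact Finset.sum_congr rfl fun w _ => by split_ifs <;> simp

theorem adjSum_const (c : ℝ) (v : G.V) : G.adjSum (fun _ => c) v = c * G.deg v := by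
  rw [deg_eq_adjSum, ← adjSum_const_mul]; simp

theorem adjSum_sum {ι : Type*} (s : Finset ι) (f : ι → G.V → ℝ) (v : G.V) :
    G.adjSum (fun w => ∑ i ∈ s, f i w) v = ∑ i ∈ s, G.adjSum (f i) v := by
  unfold adjSum
  rw [Finset.sum_comm]
  exact Finset.sum_congr rfl fun w _ => by split_ifs <;> simp

theorem sum_stepProb_mul (f : G.V → ℝ) (v : G.V) :
    ∑ w, G.stepProb v w * f w = G.adjSum f v / G.deg v := by
  unfold adjSum stepProb
  rw [Finset.sum_div]
  exact Finset.sum_congr rfl fun w _ => by split_ifs <;> ring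

theorem sum_adjSum (f : G.V → ℝ) : ∑ v, G.adjSum f v = ∑ v, G.deg v * f v := by
  classical
  simp only [deg_eq_adjSum]
  unfold adjSum
  rw [Finset.sum_comm]
  refine Finset.sum_congr rfl fun v _ => ?_
  rw [Finset.sum_mul]
  refine Finset.sum_congr rfl fun w _ => ?_
  simp only [G.graph.adj_comm w v]
  split_ifs <;> simp

theorem sum_deg : ∑ v, (G.deg v : ℝ) = 2 * G.numEdges := by
  classical
  have h := G.graph.sum_degrees_eq_twice_card_edges
  have h2 : G.numEdges = G.graph.edgeFinset.card := by
    unfold numEdges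
    rw [← SimpleGraph.coe_edgeFinset, Set.ncard_coe_finset]
  rw [h2]
  unfold deg
  exact_mod_cast (by convert h)

theorem deg_pos (hc : G.graph.Connected) (he : 1 ≤ G.numEdges) (v : G.V) : 0 < (G.deg v : ℝ) := by
  classical
  have hne : G.graph.edgeSet.Nonempty := by
    rw [← Set.ncard_pos]; exact he
  obtain ⟨e, hmem⟩ := hne
  induction e with | h a b =>
  have : Nontrivial G.V := ⟨a, b, G.graph.ne_of_adj hmem⟩
  unfold deg
  exact_mod_cast hc.preconnected.degree_pos_of_nontrivial v

/-! ### Maximum principle and the linear system for hitting times. -/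

/-- The maximum principle for subharmonic functions vanishing at a vertex. -/
theorem nonpos_of_subharmonic (hc : G.graph.Connected) (j : G.V)
    (u : G.V → ℝ) (hj : u j = 0) (hu : ∀ i, i ≠ j → G.deg i * u i ≤ G.adjSum u i) (i : G.V) :
    u i ≤ 0 := by
  classical
  obtain ⟨a, -, ha⟩ := Finset.exists_max_image Finset.univ u ⟨i, Finset.mem_univ i⟩
  suffices h : ∀ v w : G.V, G.graph.Walk v w → w = j → u v = u a → u a = 0 by
    obtain ⟨p⟩ := hc.preconnected a j
    exact (ha i (Finset.mem_univ i)).trans (h a j p rfl rfl).le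
  intro v w p
  induction p with
  | nil => rintro rfl h; rw [← h, hj]
  | @cons v x w hvx p ih =>
    intro hw hv
    by_cases hvj : v = j
    · rw [← hv, hvj, hj]
    -- The maximum spreads to every neighbour: one smaller neighbour would push the neighbour sum
    -- strictly below `deg v * u a`.
    refine ih hw (le_antisymm (ha x (Finset.mem_univ x)) ?_)
    by_contra! hlt
    have h1 := hu v hvj
    rw [hv, mul_comm, ← adjSum_const] at h1
    refine absurd h1 (not_le.2 ?_)
    unfold adjSum
    refine Finset.sum_lt_sum (fun y _ => ?_) ⟨x, Finset.mem_univ x, by simpa [hvx] using hlt⟩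
    split_ifs
    · exact ha y (Finset.mem_univ y)
    · exact le_rfl

/-- The linear system that characterises the expected hitting times of `j`. -/
structure IsHittingFunction (G : FiniteGraph.{u}) (j : G.V) (h : G.V → ℝ) : Prop where
  self : h j = 0
  step : ∀ i, i ≠ j → G.deg i * h i = G.deg i + G.adjSum h i

theorem IsHittingFunction.nonneg (hc : G.graph.Connected) (he : 1 ≤ G.numEdges) {j : G.V}
    {h : G.V → ℝ} (hh : G.IsHittingFunction j h) (i : G.V) : 0 ≤ h i := by
  have := nonpos_of_subharmonic hc j (fun v => (-1) * h v) (by simp [hh.self])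
    (fun v hv => by
      rw [adjSum_const_mul]
      have := hh.step v hv
      have := deg_pos hc he v
      linarith) i
  linarith

theorem IsHittingFunction.eq (hc : G.graph.Connected) {j : G.V}
    {h g : G.V → ℝ} (hh : G.IsHittingFunction j h) (hg : G.IsHittingFunction j g) : h = g := by
  have key : ∀ {h g : G.V → ℝ}, G.IsHittingFunction j h → G.IsHittingFunction j g →
      ∀ i, h i ≤ g i := by
    intro h g hh hg i
    have := nonpos_of_subharmonic hc j (fun v => h v + (-1) * g v) (by simp [hh.self, hg.self])
      (fun v hv => by
        rw [adjSum_add, adjSum_const_mul]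
        have := hh.step v hv
        have := hg.step v hv
        linarith) i
    linarith
  exact funext fun i => le_antisymm (key hh hg i) (key hg hh i)

/-- The maximum principle, applied to `u` and `-u`, makes the operator of the system injective,
hence surjective in finite dimension. -/
theorem exists_isHittingFunction (hc : G.graph.Connected) (j : G.V) :
    ∃ h, G.IsHittingFunction j h := by
  classical
  let L : (G.V → ℝ) →ₗ[ℝ] (G.V → ℝ) :=
    { toFun := fun u i => if i = j then u j else G.deg i * u i - G.adjSum u i
      map_add' := fun u v => by
        funext i
        have := adjSum_add u v i
        simp only [Pi.add_apply]
        split_ifs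
        · rfl
        · change _ - G.adjSum (fun w => u w + v w) i = _
          rw [this]; ring
      map_smul' := fun c u => by
        funext i
        have := adjSum_const_mul c u i
        simp only [Pi.smul_apply, smul_eq_mul, RingHom.id_apply]
        split_ifs
        · rfl
        · change _ - G.adjSum (fun w => c * u w) i = _
          rw [this]; ring }
  have hLj : ∀ u, L u j = u j := fun u => if_pos rfl
  have hLi : ∀ u i, i ≠ j → L u i = G.deg i * u i - G.adjSum u i := fun u i hi => if_neg hi
  have hinj : Function.Injective L := by
    rw [← LinearMap.ker_eq_bot, LinearMap.ker_eq_bot']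
    intro u hu
    have key : ∀ u, L u = 0 → ∀ i, u i ≤ 0 := by
      intro u hu
      refine nonpos_of_subharmonic hc j u (by rw [← hLj u, hu]; rfl) fun i hi => ?_
      have := hLi u i hi
      rw [hu, Pi.zero_apply] at this
      linarith
    funext i
    refine le_antisymm (key u hu i) ?_
    have := key (-u) (by rw [map_neg, hu, neg_zero]) i
    simpa using this
  obtain ⟨h, hh⟩ := (LinearMap.injective_iff_surjective.1 hinj)
    (fun i => if i = j then 0 else (G.deg i : ℝ))
  refine ⟨h, by rw [← hLj h, hh]; simp, fun i hi => ?_⟩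
  have := hLi h i hi
  rw [hh] at this
  simp only [if_neg hi] at this
  linarith

/-! ### Expected hitting times as solutions of the system. -/

theorem stepProb_nonneg (a b : G.V) : 0 ≤ G.stepProb a b := by
  unfold stepProb; split_ifs <;> positivity

theorem hittingTail_nonneg (i j : G.V) (t : ℕ) : 0 ≤ G.hittingTail i j t := by
  unfold hittingTail pathProb
  refine Finset.sum_nonneg fun x _ => ?_
  split_ifs
  · exact Finset.prod_nonneg fun s _ => stepProb_nonneg _ _
  · exact le_rfl
  · exact le_rfl

theorem hittingTail_self (j : G.V) (t : ℕ) : G.hittingTail j j t = 0 := by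
  unfold hittingTail pathProb
  refine Finset.sum_eq_zero fun x _ => ?_
  split_ifs with h h'
  · exact absurd h' (h 0)
  · rfl
  · rfl

theorem hittingTail_zero {i j : G.V} (hij : i ≠ j) : G.hittingTail i j 0 = 1 := by
  classical
  unfold hittingTail pathProb
  rw [Finset.sum_eq_single (fun _ => i)]
  · simp [hij]
  · intro x _ hx
    have : x 0 ≠ i := fun h => hx (funext fun s => by
      rw [show s = 0 from Fin.fin_one_eq_zero s, h])
    simp [this]
  · simp

/-- Markov property at time 1: the first vertex is split off each path with `Fin.consEquiv`. -/
theorem hittingTail_succ {i j : G.V} (hij : i ≠ j) (t : ℕ) :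
    G.hittingTail i j (t + 1) = ∑ l, G.stepProb i l * G.hittingTail l j t := by
  classical
  unfold hittingTail
  rw [← (Fin.consEquiv (fun _ : Fin (t + 2) => G.V)).sum_comp, Fintype.sum_prod_type]
  rw [Finset.sum_eq_single i]
  · simp only [Finset.mul_sum]
    rw [Finset.sum_comm]
    refine Finset.sum_congr rfl fun x _ => ?_
    rw [Finset.sum_eq_single (x 0)]
    · simp only [Fin.consEquiv_apply, Fin.forall_fin_succ (n := t + 1), Fin.cons_zero,
        Fin.cons_succ, pathProb, Fin.prod_univ_succ (n := t), if_true, Fin.castSucc_zero,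
        ← Fin.succ_castSucc, ne_eq, hij, not_false_eq_true, true_and]
      split_ifs <;> simp
    · intro l _ hl
      simp [pathProb, hl.symm]
    · simp
  · intro a _ ha
    refine Finset.sum_eq_zero fun x _ => ?_
    simp [pathProb, Fin.consEquiv_apply, ha]
  · simp

/-- Partial sums of the tails are bounded by the hitting function. -/
theorem IsHittingFunction.sum_hittingTail_le (hc : G.graph.Connected) (he : 1 ≤ G.numEdges)
    {j : G.V} {h : G.V → ℝ} (hh : G.IsHittingFunction j h) (T : ℕ) (i : G.V) :
    ∑ t ∈ Finset.range T, G.hittingTail i j t ≤ h i := by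
  induction T generalizing i with
  | zero => simpa using hh.nonneg hc he i
  | succ T ih =>
    by_cases hij : i = j
    · subst hij
      simp [hittingTail_self, hh.self]
    rw [Finset.sum_range_succ', hittingTail_zero hij]
    simp only [hittingTail_succ hij]
    rw [Finset.sum_comm]
    simp only [← Finset.mul_sum]
    have h1 : ∑ l, G.stepProb i l * ∑ t ∈ Finset.range T, G.hittingTail l j t
        ≤ ∑ l, G.stepProb i l * h l :=
      Finset.sum_le_sum fun l _ => mul_le_mul_of_nonneg_left (ih l) (stepProb_nonneg _ _)
    rw [sum_stepProb_mul h] at h1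
    have h2 := hh.step i hij
    have h3 := deg_pos hc he i
    have h4 : h i = 1 + G.adjSum h i / G.deg i := by field_simp; linarith
    linarith

/-- Bounded partial sums make the tails summable; the first-step recursion then shows that their sum
solves the same system, and uniqueness finishes. -/
theorem IsHittingFunction.expectedHittingTime_eq (hc : G.graph.Connected) (he : 1 ≤ G.numEdges)
    {j : G.V} {h : G.V → ℝ} (hh : G.IsHittingFunction j h) (i : G.V) :
    G.expectedHittingTime i j = ENNReal.ofReal (h i) := by
  have hs : ∀ i, Summable (G.hittingTail i j) := fun i =>
    summable_of_sum_range_le (hittingTail_nonneg i j) fun T => hh.sum_hittingTail_le hc he T i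
  have hg : G.IsHittingFunction j (fun i => ∑' t, G.hittingTail i j t) := by
    refine ⟨by simp [hittingTail_self], fun i hij => ?_⟩
    have h3 := deg_pos hc he i
    rw [(hs i).tsum_eq_zero_add, hittingTail_zero hij]
    simp only [hittingTail_succ hij]
    rw [Summable.tsum_finsetSum fun l _ => (hs l).mul_left _]
    simp only [tsum_mul_left]
    rw [sum_stepProb_mul]
    field_simp
  rw [hh.eq hc hg]
  exact (ENNReal.ofReal_tsum_of_nonneg (hittingTail_nonneg i j) (hs i)).symm

/-! ### Return times and independence of the starting vertex. -/

open Classical in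
/-- The equation at the target itself involves the return time `2 m / d_j`. -/
theorem IsHittingFunction.full_step {j : G.V} {h : G.V → ℝ} (hh : G.IsHittingFunction j h)
    (i : G.V) :
    G.deg i * h i = G.deg i + G.adjSum h i - if i = j then 2 * (G.numEdges : ℝ) else 0 := by
  by_cases hij : i = j
  · subst hij
    -- Summed over all vertices, `adjSum h` and `deg * h` agree, so the equations away from the
    -- target determine the one at the target.
    have h1 := G.sum_adjSum h
    rw [← Finset.add_sum_erase _ _ (Finset.mem_univ i),
      ← Finset.add_sum_erase _ (fun v => (G.deg v : ℝ) * h v) (Finset.mem_univ i)] at h1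
    have h2 := G.sum_deg
    rw [← Finset.add_sum_erase _ _ (Finset.mem_univ i)] at h2
    have h3 : ∑ v ∈ Finset.univ.erase i, (G.deg v : ℝ) * h v
        = ∑ v ∈ Finset.univ.erase i, (G.deg v : ℝ) + ∑ v ∈ Finset.univ.erase i, G.adjSum h v := by
      rw [← Finset.sum_add_distrib]
      exact Finset.sum_congr rfl fun v hv => hh.step v (Finset.ne_of_mem_erase hv)
    simp only [if_true]
    linarith
  · simp [hij, hh.step i hij]

/-- The mean hitting time of a stationary target does not depend on the starting vertex. -/
theorem sum_deg_mul_hitting_eq (hc : G.graph.Connected)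
    {H : G.V → G.V → ℝ} (hH : ∀ j, G.IsHittingFunction j (H j)) (i i' : G.V) :
    ∑ j, G.deg j * H j i = ∑ j, G.deg j * H j i' := by
  classical
  set K : G.V → ℝ := fun v => ∑ j, G.deg j * H j v with hK
  -- The source terms add up to `2 m d_v`, which the return term of the target `v` cancels; so `K`
  -- is harmonic everywhere, hence constant.
  have hharm : ∀ v, G.deg v * K v = G.adjSum K v := by
    intro v
    rw [hK, adjSum_sum]
    simp only [adjSum_const_mul, Finset.mul_sum]
    have h1 : ∀ j, (G.deg v : ℝ) * (G.deg j * H j v)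
        = G.deg j * G.deg v + G.deg j * G.adjSum (H j) v
          - if v = j then G.deg j * (2 * (G.numEdges : ℝ)) else 0 := fun j => by
      have := (hH j).full_step v
      split_ifs at this ⊢ <;> linear_combination (G.deg j : ℝ) * this
    simp only [h1, Finset.sum_sub_distrib, Finset.sum_add_distrib, Finset.sum_ite_eq,
      Finset.mem_univ, if_true, ← Finset.sum_mul, sum_deg]
    ring
  have key : ∀ a b, K a ≤ K b := fun a b => by
    have := nonpos_of_subharmonic hc b (fun v => K v + -K b) (by simp)
      (fun v _ => by rw [adjSum_add, adjSum_const, ← hharm]; linarith) a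
    linarith
  exact le_antisymm (key i i') (key i' i)

theorem isKemenyConstant_of_hitting (hc : G.graph.Connected) (he : 1 ≤ G.numEdges)
    {H : G.V → G.V → ℝ} (hH : ∀ j, G.IsHittingFunction j (H j)) {K : ℝ} (i₀ : G.V)
    (hK : ∑ j, G.deg j * H j i₀ = 2 * G.numEdges * K) : G.IsKemenyConstant K := by
  intro i
  have hm : (0 : ℝ) < G.numEdges := by exact_mod_cast he
  have h1 : G.meanHittingTime i = ENNReal.ofReal K := by
    unfold meanHittingTime
    have h2 : ∀ j, 0 ≤ G.stationary j := fun j => by unfold stationary; positivity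
    simp only [(hH _).expectedHittingTime_eq hc he, ← ENNReal.ofReal_mul (h2 _)]
    rw [← ENNReal.ofReal_sum_of_nonneg fun j _ => mul_nonneg (h2 j) ((hH j).nonneg hc he i)]
    congr 1
    have h3 : ∑ j, G.stationary j * H j i = (∑ j, G.deg j * H j i) / (2 * G.numEdges) := by
      rw [Finset.sum_div]
      exact Finset.sum_congr rfl fun j _ => by unfold stationary; ring
    rw [h3, sum_deg_mul_hitting_eq hc hH i i₀, hK]
    field_simp
  have h0 : 0 ≤ K := by
    have : 0 ≤ 2 * G.numEdges * K := hK ▸ Finset.sum_nonneg fun j _ =>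
      mul_nonneg (Nat.cast_nonneg _) ((hH j).nonneg hc he i₀)
    exact nonneg_of_mul_nonneg_right this (by positivity)
  rw [h1]
  exact ⟨ENNReal.ofReal_ne_top, ENNReal.toReal_ofReal h0⟩

/-! ### Sums over the subdivision -/

/-- The sum of a function over the two ends of an unordered pair. -/
def endSum {α : Type*} (g : α → ℝ) (e : Sym2 α) : ℝ :=
  Sym2.lift ⟨fun a b => g a + g b, fun _ _ => add_comm _ _⟩ e

@[simp] theorem endSum_mk {α : Type*} (g : α → ℝ) (a b : α) : endSum g s(a, b) = g a + g b := rfl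

open Classical in
theorem endSum_eq_sum (g : G.V → ℝ) {e : Sym2 G.V} (he : e ∈ G.graph.edgeSet) :
    ∑ v, (if v ∈ e then g v else 0) = endSum g e := by
  induction e with | h a b =>
  have hab : a ≠ b := G.graph.ne_of_adj he
  rw [endSum_mk, ← Finset.sum_filter, ← Finset.sum_pair hab]
  refine Finset.sum_congr ?_ fun _ _ => rfl
  ext v
  simp

open Classical in
theorem sum_incident_eq_adjSum (φ : Sym2 G.V → ℝ) (v : G.V) :
    ∑ e : G.graph.edgeSet, (if v ∈ (e : Sym2 G.V) then φ e else 0)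
      = G.adjSum (fun w => φ s(v, w)) v := by
  unfold adjSum
  rw [← Finset.sum_filter, ← Finset.sum_filter]
  symm
  refine Finset.sum_bij (fun w hw => ⟨s(v, w), (Finset.mem_filter.1 hw).2⟩) ?_ ?_ ?_ ?_
  · intro w hw
    simp
  · intro w _ w' _ h
    have h' : s(v, w) = s(v, w') := congrArg Subtype.val h
    exact Sym2.congr_right.1 h'
  · rintro ⟨e, he⟩ h
    obtain ⟨w, rfl⟩ := (Finset.mem_filter.1 h).2
    exact ⟨w, by simpa using he, rfl⟩
  · intro w _
    rfl

open Classical in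
theorem sum_edges_endSum (g : G.V → ℝ) :
    ∑ e : G.graph.edgeSet, endSum g e = ∑ v, G.deg v * g v := by
  have h : ∀ e : G.graph.edgeSet, endSum g e = ∑ v, if v ∈ (e : Sym2 G.V) then g v else 0 :=
    fun e => (endSum_eq_sum g e.2).symm
  simp only [h]
  rw [Finset.sum_comm]
  refine Finset.sum_congr rfl fun v _ => ?_
  rw [sum_incident_eq_adjSum (fun _ => g v) v, adjSum_const, mul_comm]

open Classical in
theorem two_mul_sum_edges (φ : Sym2 G.V → ℝ) :
    2 * ∑ e : G.graph.edgeSet, φ e = ∑ v, G.adjSum (fun w => φ s(v, w)) v := by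
  simp only [← sum_incident_eq_adjSum]
  rw [Finset.sum_comm, Finset.mul_sum]
  refine Finset.sum_congr rfl fun e _ => ?_
  rw [endSum_eq_sum (fun _ => φ e) e.2]
  obtain ⟨e, he⟩ := e
  induction e with | h a b => simp; ring

open Classical in
theorem card_edgeSet : (Fintype.card G.graph.edgeSet : ℝ) = G.numEdges := by
  unfold numEdges
  rw [← Nat.card_coe_set_eq, Nat.card_eq_fintype_card]

/-- A vertex of the original graph, as a vertex of the subdivision. -/
def oldVert (k : ℕ) (v : G.V) : (parallelSubdivision k G).V := Sum.inl v

/-- A subdividing vertex. -/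
def newVert (k : ℕ) (p : G.graph.edgeSet × Fin k) : (parallelSubdivision k G).V := Sum.inr p

theorem exists_old_or_new {k : ℕ} (y : (parallelSubdivision k G).V) :
    (∃ v, oldVert k v = y) ∨ ∃ p, newVert k p = y := by
  rcases y with v | p
  · exact .inl ⟨v, rfl⟩
  · exact .inr ⟨p, rfl⟩

@[simp] theorem oldVert_inj {k : ℕ} {v w : G.V} : oldVert k v = oldVert k w ↔ v = w :=
  Sum.inl_injective.eq_iff

@[simp] theorem newVert_ne_oldVert {k : ℕ} {v : G.V} {p : G.graph.edgeSet × Fin k} :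
    newVert k p ≠ oldVert k v :=
  Sum.inr_ne_inl

@[simp] theorem oldVert_ne_newVert {k : ℕ} {v : G.V} {p : G.graph.edgeSet × Fin k} :
    oldVert k v ≠ newVert k p :=
  Sum.inl_ne_inr

@[simp] theorem adj_old_new {k : ℕ} {v : G.V} {p : G.graph.edgeSet × Fin k} :
    (parallelSubdivision k G).graph.Adj (oldVert k v) (newVert k p) ↔ v ∈ (p.1 : Sym2 G.V) :=
  Iff.rfl

@[simp] theorem adj_new_old {k : ℕ} {v : G.V} {p : G.graph.edgeSet × Fin k} :
    (parallelSubdivision k G).graph.Adj (newVert k p) (oldVert k v) ↔ v ∈ (p.1 : Sym2 G.V) :=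
  Iff.rfl

@[simp] theorem not_adj_old_old {k : ℕ} {v w : G.V} :
    ¬ (parallelSubdivision k G).graph.Adj (oldVert k v) (oldVert k w) :=
  id

@[simp] theorem not_adj_new_new {k : ℕ} {p q : G.graph.edgeSet × Fin k} :
    ¬ (parallelSubdivision k G).graph.Adj (newVert k p) (newVert k q) :=
  id

open Classical in
theorem sum_parallel (k : ℕ) (F : (parallelSubdivision k G).V → ℝ) :
    ∑ y, F y = ∑ v, F (oldVert k v) + ∑ e : G.graph.edgeSet, ∑ l : Fin k, F (newVert k (e, l)) := by
  refine (Fintype.sum_sum_type F).trans ?_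
  rw [Fintype.sum_prod_type]
  rfl

open Classical in
theorem adjSum_parallel_inl (k : ℕ) (F : (parallelSubdivision k G).V → ℝ) (v : G.V) :
    (parallelSubdivision k G).adjSum F (oldVert k v)
      = ∑ e : G.graph.edgeSet, ∑ l : Fin k,
          if v ∈ (e : Sym2 G.V) then F (newVert k (e, l)) else 0 := by
  unfold adjSum
  rw [sum_parallel]
  simp

theorem adjSum_parallel_inl_of_eq (k : ℕ) (F : (parallelSubdivision k G).V → ℝ)
    (φ : Sym2 G.V → ℝ) (hF : ∀ e l, F (newVert k (e, l)) = φ e) (v : G.V) :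
    (parallelSubdivision k G).adjSum F (oldVert k v) = k * G.adjSum (fun w => φ s(v, w)) v := by
  classical
  rw [adjSum_parallel_inl, ← sum_incident_eq_adjSum, Finset.mul_sum]
  refine Finset.sum_congr rfl fun e _ => ?_
  simp [hF]

theorem adjSum_parallel_inr (k : ℕ) (F : (parallelSubdivision k G).V → ℝ)
    (e : G.graph.edgeSet) (l : Fin k) :
    (parallelSubdivision k G).adjSum F (newVert k (e, l)) = endSum (fun v => F (oldVert k v)) e := by
  classical
  unfold adjSum
  rw [sum_parallel, ← endSum_eq_sum _ e.2]
  simp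

theorem deg_parallel_inl (k : ℕ) (v : G.V) :
    ((parallelSubdivision k G).deg (oldVert k v) : ℝ) = k * G.deg v := by
  rw [deg_eq_adjSum, adjSum_parallel_inl_of_eq k _ (fun _ => 1) (fun _ _ => rfl), deg_eq_adjSum]

theorem deg_parallel_inr (k : ℕ) (e : G.graph.edgeSet) (l : Fin k) :
    ((parallelSubdivision k G).deg (newVert k (e, l)) : ℝ) = 2 := by
  rw [deg_eq_adjSum, adjSum_parallel_inr]
  obtain ⟨e, he⟩ := e
  induction e with | h a b => simp; norm_num

theorem numEdges_parallel (k : ℕ) :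
    ((parallelSubdivision k G).numEdges : ℝ) = 2 * k * G.numEdges := by
  classical
  have h := (parallelSubdivision k G).sum_deg
  rw [sum_parallel] at h
  simp only [deg_parallel_inl, deg_parallel_inr, ← Finset.mul_sum, sum_deg, Finset.sum_const,
    Finset.card_univ, Fintype.card_fin, nsmul_eq_mul, card_edgeSet] at h
  linarith

theorem numVerts_parallel (k : ℕ) :
    (parallelSubdivision k G).numVerts = G.numVerts + k * G.numEdges := by
  classical
  have h := sum_parallel (G := G) k (fun _ => 1)
  simp only [Finset.sum_const, Finset.card_univ, Fintype.card_fin, nsmul_eq_mul, mul_one,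
    card_edgeSet] at h
  unfold numVerts
  have h' : ((Fintype.card (parallelSubdivision k G).V : ℕ) : ℝ)
      = ((Fintype.card G.V + k * G.numEdges : ℕ) : ℝ) := by
    push_cast; linarith
  exact_mod_cast h'

theorem connected_parallel (hc : G.graph.Connected) {k : ℕ} (hk : 1 ≤ k) :
    (parallelSubdivision k G).graph.Connected := by
  let S := (parallelSubdivision k G).graph
  have hadj : ∀ (v : G.V) (e : G.graph.edgeSet) (l : Fin k), v ∈ (e : Sym2 G.V) →
      S.Adj (oldVert k v) (newVert k (e, l)) := fun v e l h => h
  have hinl : ∀ v w : G.V, G.graph.Walk v w → S.Reachable (oldVert k v) (oldVert k w) := by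
    intro v w p
    induction p with
    | nil => rfl
    | @cons v x w hvx p ih =>
      refine SimpleGraph.Reachable.trans ?_ ih
      exact (hadj v ⟨s(v, x), hvx⟩ ⟨0, hk⟩ (Sym2.mem_mk_left v x)).reachable.trans
        (hadj x ⟨s(v, x), hvx⟩ ⟨0, hk⟩ (Sym2.mem_mk_right v x)).reachable.symm
  obtain ⟨v₀⟩ := hc.nonempty
  have h0 : ∀ y, S.Reachable (oldVert k v₀) y := by
    intro y
    obtain ⟨v, rfl⟩ | ⟨⟨⟨e, he⟩, l⟩, rfl⟩ := exists_old_or_new y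
    · exact hinl _ _ (hc.preconnected v₀ v).some
    · induction e with | h a b =>
      exact (hinl _ _ (hc.preconnected v₀ a).some).trans
        (hadj a ⟨s(a, b), he⟩ l (Sym2.mem_mk_left a b)).reachable
  exact { preconnected := fun x y => (h0 x).symm.trans (h0 y), nonempty := ⟨oldVert k v₀⟩ }

/-! ### Hitting times in the subdivision -/

/-- Expected hitting times of an old vertex in the subdivision. -/
def hittingInl (k : ℕ) (h : G.V → ℝ) : (parallelSubdivision k G).V → ℝ
  | .inl v => 4 * h v
  | .inr p => 1 + 2 * endSum h p.1

@[simp] theorem hittingInl_old (k : ℕ) (h : G.V → ℝ) (v : G.V) :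
    hittingInl k h (oldVert k v) = 4 * h v := rfl

@[simp] theorem hittingInl_new (k : ℕ) (h : G.V → ℝ) (p : G.graph.edgeSet × Fin k) :
    hittingInl k h (newVert k p) = 1 + 2 * endSum h p.1 := rfl

/-- From a new vertex, one step leads to a uniform end of its edge, whence `1 + (4 h a + 4 h b) /
2`; at old vertices the equation is `2k` times that of `G`. -/
theorem isHittingFunction_inl (k : ℕ) {j : G.V} {h : G.V → ℝ} (hh : G.IsHittingFunction j h) :
    (parallelSubdivision k G).IsHittingFunction (oldVert k j) (hittingInl k h) := by
  refine ⟨by simp [hh.self], ?_⟩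
  intro y hne
  obtain ⟨v, rfl⟩ | ⟨⟨e, l⟩, rfl⟩ := exists_old_or_new y
  · have hvj : v ≠ j := fun h => hne (by rw [h])
    rw [deg_parallel_inl, adjSum_parallel_inl_of_eq k _ (fun e => 1 + 2 * endSum h e)
      (fun _ _ => rfl)]
    simp only [endSum_mk]
    rw [adjSum_add, adjSum_const_mul, adjSum_add, adjSum_const, adjSum_const]
    simp only [hittingInl_old]
    linear_combination 2 * k * hh.step v hvj
  · rw [deg_parallel_inr, adjSum_parallel_inr]
    obtain ⟨e, he⟩ := e
    induction e with | h a b =>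
    simp; ring

/-- The commute time between the ends of an unordered pair. -/
def commute {α : Type*} (H : α → α → ℝ) (e : Sym2 α) : ℝ :=
  Sym2.lift ⟨fun a b => H b a + H a b, fun _ _ => add_comm _ _⟩ e

@[simp] theorem commute_mk {α : Type*} (H : α → α → ℝ) (a b : α) :
    commute H s(a, b) = H b a + H a b := rfl

open Classical in
/-- Expected hitting times of a new vertex in the subdivision. -/
noncomputable def hittingInr (k : ℕ) (H : G.V → G.V → ℝ) (x : G.graph.edgeSet × Fin k)
    (y : (parallelSubdivision k G).V) : ℝ :=
  endSum (fun a => hittingInl k (H a) y) x.1 / 2 + (2 * k * G.numEdges - 1 - commute H x.1)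
    + (-(2 * k * G.numEdges)) * if y = newVert k x then 1 else 0

/-- The average over `a` and `b` has defects `2km` at both ends, half the return term `4km`. The
neighbours of the target are exactly `a` and `b`, so the point mass `-2km` there cancels them. The
average equals `1 + commute` at the target, which fixes the constant. -/
theorem isHittingFunction_inr (k : ℕ) {H : G.V → G.V → ℝ} (hH : ∀ j, G.IsHittingFunction j (H j))
    (x : G.graph.edgeSet × Fin k) :
    (parallelSubdivision k G).IsHittingFunction (newVert k x) (hittingInr k H x) := by
  classical
  obtain ⟨⟨e, he⟩, l⟩ := x
  induction e with | h a b =>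
  have hab : a ≠ b := G.graph.ne_of_adj he
  set x : G.graph.edgeSet × Fin k := (⟨s(a, b), he⟩, l) with hx
  set C : ℝ := 2 * k * G.numEdges - 1 - commute H s(a, b) with hC
  set F : G.V → (parallelSubdivision k G).V → ℝ := fun a => hittingInl k (H a) with hF
  have hform : hittingInr k H x = fun y => ((1 / 2) * (F a y + F b y) + C)
      + (-(2 * k * G.numEdges)) * if y = newVert k x then 1 else 0 := by
    funext y
    simp only [hittingInr, hx, endSum_mk, hF, hC]
    ring
  have ha := (isHittingFunction_inl k (hH a)).full_step
  have hb := (isHittingFunction_inl k (hH b)).full_step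
  have hδ : ∀ y, (parallelSubdivision k G).adjSum (fun z => if z = newVert k x then 1 else 0) y
      = if (parallelSubdivision k G).graph.Adj y (newVert k x) then 1 else 0 := by
    intro y
    unfold adjSum
    rw [Finset.sum_eq_single (newVert k x)]
    · simp
    · intro z _ hz; simp [hz]
    · simp
  refine ⟨?_, fun y hy => ?_⟩
  · rw [hform]
    simp only [hF, hittingInl_new, hC, hx, endSum_mk, commute_mk, (hH a).self, (hH b).self, if_true]
    ring
  · rw [hform, adjSum_add, adjSum_add, adjSum_const_mul, adjSum_const_mul, adjSum_add,
      adjSum_const, hδ]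
    simp only [if_neg hy]
    have hA : (if (parallelSubdivision k G).graph.Adj y (newVert k x) then (1 : ℝ) else 0)
        = (if y = oldVert k a then 1 else 0) + (if y = oldVert k b then 1 else 0) := by
      obtain ⟨v, rfl⟩ | ⟨q, rfl⟩ := exists_old_or_new y
      · simp only [hx, adj_old_new, Sym2.mem_iff, oldVert_inj]
        by_cases hva : v = a
        · subst hva; simp [hab]
        · simp [hva]
      · simp
    rw [hA]
    have h1 := ha y
    have h2 := hb y
    rw [numEdges_parallel] at h1 h2
    split_ifs at h1 h2 ⊢ <;> linear_combination (1 / 2) * h1 + (1 / 2) * h2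

/-- Expected hitting times `hittingParallel k H y z` of `y` from `z` in the subdivision. -/
noncomputable def hittingParallel (k : ℕ) (H : G.V → G.V → ℝ) :
    (parallelSubdivision k G).V → (parallelSubdivision k G).V → ℝ
  | .inl j => hittingInl k (H j)
  | .inr x => hittingInr k H x

@[simp] theorem hittingParallel_old (k : ℕ) (H : G.V → G.V → ℝ) (j : G.V) :
    hittingParallel k H (oldVert k j) = hittingInl k (H j) := rfl

@[simp] theorem hittingParallel_new (k : ℕ) (H : G.V → G.V → ℝ) (x : G.graph.edgeSet × Fin k) :
    hittingParallel k H (newVert k x) = hittingInr k H x := rfl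

/-! ### Kemeny's constant of the subdivision and of its iterates. -/

theorem kemeny_parallel (hc : G.graph.Connected) (he : 1 ≤ G.numEdges) {K : ℝ}
    (hK : G.IsKemenyConstant K) {k : ℕ} (hk : 1 ≤ k) :
    (parallelSubdivision k G).IsKemenyConstant
      (4 * K + (1 + 2 * (k : ℝ) * G.numEdges - 2 * G.numVerts) / 2) := by
  classical
  choose H hH using exists_isHittingFunction hc
  obtain ⟨i⟩ := hc.nonempty
  have hm : (0 : ℝ) < G.numEdges := by exact_mod_cast he
  have hKe : ∑ j, G.deg j * H j i = 2 * G.numEdges * K := by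
    have : Nonempty G.V := ⟨i⟩
    have h := isKemenyConstant_of_hitting hc he hH (K := (∑ j, G.deg j * H j i) / (2 * G.numEdges))
      i (by field_simp)
    rw [hK.unique h]
    field_simp
  have he' : 1 ≤ (parallelSubdivision k G).numEdges := by
    have h : ((parallelSubdivision k G).numEdges : ℝ) = ((2 * k * G.numEdges : ℕ) : ℝ) := by
      rw [numEdges_parallel]; push_cast; rfl
    have h' : (parallelSubdivision k G).numEdges = 2 * k * G.numEdges := by exact_mod_cast h
    rw [h']
    have := Nat.mul_pos hk he
    nlinarith
  -- Foster's identity: the equation at the target says that the hitting times of `v` from its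
  -- neighbours sum to `2m - d_v`; then sum over `v`.
  have hcomm : ∑ e : G.graph.edgeSet, commute H e
      = 2 * G.numEdges * G.numVerts - 2 * G.numEdges := by
    have h1 := two_mul_sum_edges (commute H)
    simp only [commute_mk, adjSum_add] at h1
    rw [Finset.sum_add_distrib] at h1
    have h2 : ∀ v, G.adjSum (H v) v = 2 * G.numEdges - G.deg v := fun v => by
      have := (hH v).full_step v
      rw [(hH v).self, if_pos rfl] at this
      linarith
    have h3 : ∑ v, G.adjSum (fun w => H w v) v = ∑ v, G.adjSum (H v) v := by
      unfold adjSum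
      rw [Finset.sum_comm]
      simp only [G.graph.adj_comm]
    rw [h3] at h1
    simp only [h2, Finset.sum_sub_distrib, sum_deg, Finset.sum_const, Finset.card_univ,
      nsmul_eq_mul] at h1
    unfold numVerts
    linarith
  refine isKemenyConstant_of_hitting (connected_parallel hc hk) he'
    (H := hittingParallel k H) (fun y => ?_) (oldVert k i) ?_
  · obtain ⟨j, rfl⟩ | ⟨x, rfl⟩ := exists_old_or_new y
    · exact isHittingFunction_inl k (hH j)
    · exact isHittingFunction_inr k hH x
  · rw [sum_parallel, numEdges_parallel]
    have hinr : ∀ (e : G.graph.edgeSet) (l : Fin k), hittingInr k H (e, l) (oldVert k i)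
        = 2 * endSum (fun a => H a i) e + (2 * k * G.numEdges - 1) - commute H e := by
      rintro ⟨e, h⟩ l
      induction e with | h a b =>
      simp [hittingInr]; ring
    simp only [deg_parallel_inl, deg_parallel_inr, hittingParallel_old, hittingParallel_new, hinr]
    simp only [hittingInl_old, ← Finset.mul_sum, Finset.sum_const, Finset.card_univ, Fintype.card_fin,
      nsmul_eq_mul, Finset.sum_sub_distrib, Finset.sum_add_distrib, sum_edges_endSum, hcomm,
      card_edgeSet, hKe]
    have h4 : ∑ j, k * (G.deg j : ℝ) * (4 * H j i) = 4 * k * (2 * G.numEdges * K) := by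
      rw [← hKe, Finset.mul_sum]
      exact Finset.sum_congr rfl fun j _ => by ring
    rw [h4]
    ring

/-- The third term is written without the exponent `r - 1`, so that the induction can start at `r =
0`. -/
theorem iter_parallel (hc : G.graph.Connected) (he : 1 ≤ G.numEdges) {K : ℝ}
    (hK : G.IsKemenyConstant K) {k : ℕ} (hk : 2 < k) (r : ℕ) :
    (iterParallelSubdivision k G r).graph.Connected ∧
    ((iterParallelSubdivision k G r).numEdges : ℝ) = (2 * k) ^ r * G.numEdges ∧
    ((iterParallelSubdivision k G r).numVerts : ℝ)
      = G.numVerts + k * G.numEdges * ((2 * k) ^ r - 1) / (2 * k - 1) ∧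
    (iterParallelSubdivision k G r).IsKemenyConstant
      ((4 : ℝ) ^ r * K + ((4 : ℝ) ^ r - 1) / 6 * (1 - 2 * (G.numVerts : ℝ))
        + k * ((2 * k : ℝ) ^ r - 4 ^ r) / (2 * (k - 2)) * G.numEdges
        - k * (4 ^ r - 2 * k * (4 ^ r - 1) + 3 * (2 * k : ℝ) ^ r - 4)
          / (6 * (k - 2) * (2 * k - 1)) * G.numEdges) := by
  have hk' : (2 : ℝ) < k := by exact_mod_cast hk
  have h2 : (k : ℝ) - 2 ≠ 0 := by linarith
  have h1 : 2 * (k : ℝ) - 1 ≠ 0 := by linarith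
  induction r with
  | zero =>
    refine ⟨hc, by simp [iterParallelSubdivision], by simp [iterParallelSubdivision], ?_⟩
    rw [iterParallelSubdivision]
    convert hK using 1
    simp only [pow_zero]; ring
  | succ r ih =>
    obtain ⟨ihc, ihe, ihn, ihK⟩ := ih
    have he' : 1 ≤ (iterParallelSubdivision k G r).numEdges := by
      have h : ((iterParallelSubdivision k G r).numEdges : ℝ)
          = (((2 * k) ^ r * G.numEdges : ℕ) : ℝ) := by rw [ihe]; push_cast; rfl
      have h' : (iterParallelSubdivision k G r).numEdges = (2 * k) ^ r * G.numEdges := by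
        exact_mod_cast h
      rw [h']
      exact Nat.mul_pos (by positivity) he
    refine ⟨connected_parallel ihc (by omega), ?_, ?_, ?_⟩
    · rw [iterParallelSubdivision, numEdges_parallel, ihe]; ring
    · rw [iterParallelSubdivision, numVerts_parallel]
      push_cast
      rw [ihe, ihn, pow_succ]
      linear_combination -(k * G.numEdges * (2 * (k : ℝ)) ^ r) * mul_inv_cancel₀ h1
    · have h := kemeny_parallel ihc he' ihK (k := k) (by omega)
      rw [iterParallelSubdivision]
      convert h using 1
      rw [ihe, ihn]
      simp only [pow_succ]
      -- With the powers as free variables, the recursion is an identity of rational functions.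
      generalize (2 * (k : ℝ)) ^ r = A
      generalize (4 : ℝ) ^ r = B
      field_simp
      ring

end FiniteGraph

theorem mainTheorem7 (G : FiniteGraph.{u}) (n m : ℕ) (hconn : G.graph.Connected)
    (hn : G.numVerts = n) (hm : G.numEdges = m) (hpos : 1 ≤ m) :
    ∃ Ke : ℝ, G.IsKemenyConstant Ke ∧
      (∀ k : ℕ, 1 ≤ k →
        (FiniteGraph.parallelSubdivision k G).IsKemenyConstant
          (4 * Ke + (1 + 2 * (k : ℝ) * (m : ℝ) - 2 * (n : ℝ)) / 2)) ∧
      (∀ k r : ℕ, 2 < k → 1 ≤ r →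
        (FiniteGraph.iterParallelSubdivision k G r).IsKemenyConstant
          ((4 : ℝ) ^ r * Ke
            + ((4 : ℝ) ^ r - 1) / 6 * (1 - 2 * (n : ℝ))
            + (2 : ℝ) ^ (r - 1) * (k : ℝ) * ((k : ℝ) ^ r - (2 : ℝ) ^ r) / ((k : ℝ) - 2) * (m : ℝ)
            - (k : ℝ) * ((4 : ℝ) ^ r - 2 * (k : ℝ) * ((4 : ℝ) ^ r - 1)
                + 3 * (2 * (k : ℝ)) ^ r - 4)
              / (6 * ((k : ℝ) - 2) * (2 * (k : ℝ) - 1)) * (m : ℝ))) := by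
  subst hn hm
  choose H hH using FiniteGraph.exists_isHittingFunction hconn
  obtain ⟨i⟩ := hconn.nonempty
  have hm : (0 : ℝ) < G.numEdges := by exact_mod_cast hpos
  have hK := FiniteGraph.isKemenyConstant_of_hitting hconn hpos hH
    (K := (∑ j, G.deg j * H j i) / (2 * G.numEdges)) i (by field_simp)
  refine ⟨_, hK, fun k hk => FiniteGraph.kemeny_parallel hconn hpos hK hk, fun k r hk hr => ?_⟩
  convert (FiniteGraph.iter_parallel hconn hpos hK hk r).2.2.2 using 4
  obtain ⟨s, rfl⟩ := Nat.exists_eq_succ_of_ne_zero (Nat.one_le_iff_ne_zero.1 hr)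
  have h2 : (k : ℝ) - 2 ≠ 0 := by
    have : (2 : ℝ) < k := by exact_mod_cast hk
    linarith
  -- Taking `2^r` out of `(2k)^r - 4^r` and halving it gives the factor `2^(r-1)`.
  rw [mul_pow, show (4 : ℝ) = 2 * 2 by norm_num, mul_pow]
  simp only [Nat.succ_eq_add_one, Nat.add_sub_cancel, pow_succ]
  field_simp
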